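/- **Theorem 2.16.** Let $R$ be a commutative ring with identity and let $C$ be a semidualizing $R$-module; that is, $C$ has a projective resolution by finitely generated projective modules, the homothety map $R\to\operatorname{Hom}_R(C,C)$ is an isomorphism, and $\operatorname{Ext}^i_R(C,C)=0$ for all $i\ge 1$. Let $\mathrm{Ch}(R)$ be the category of unbounded complexes of $R$-modules (with differentials lowering the degree by one), and let $\operatorname{Hom}$ denote groups of morphisms of complexes. For a class $\mathcal X$ of $R$-modules closed under isomorphism, let $\widetilde{\mathcal X}$ be the class of exact complexes all of whose cycle modules lie in $\mathcal X$. Let $\mathcal P(R)$ be the class of projective modules, $\mathcal P_C(R)$ the class of modules isomorphic to $C\otimes_R P$ with $P$ projective, and $\mathcal F_C(R)$ the class of modules isomorphic to $C\otimes_R F$ with $F$ flat. A sequence $\mathbf L$ in $\mathrm{Ch}(R)$ is called $\operatorname{Hom}(-,\widetilde{\mathcal F_C(R)})$-exact if $\operatorname{Hom}(\mathbf L,H)$ is exact for every $H\in\widetilde{\mathcal F_C(R)}$. A complex $X$ is called $D_C$-projective if there is a $\operatorname{Hom}(-,\widetilde{\mathcal F_C(R)})$-exact exact sequence in $\mathrm{Ch}(R)$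 $$\cdots\to P_1\xrightarrow{f_1}P_0\xrightarrow{f_0}Q_{-1}\xrightarrow{f_{-1}}Q_{-2}\to\cdots$$ with all $P_i\in\widetilde{\mathcal P(R)}$, all $Q_i\in\widetilde{\mathcal P_C(R)}$, and $X\cong\operatorname{Im}f_0$. Then for every $X\in\mathrm{Ch}(R)$: $X$ is $D_C$-projective if and only if there exists a $\operatorname{Hom}(-,\widetilde{\mathcal F_C(R)})$-exact exact sequence in $\mathrm{Ch}(R)$ $$\cdots\to G_1\xrightarrow{\sigma_1}G_0\xrightarrow{\sigma_0}G_{-1}\to\cdots$$ in which every $G_i$ ($i\in\mathbb Z$) is $D_C$-projective and $X\cong\operatorname{Coker}\sigma_1$. -/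

import Mathlib

open CategoryTheory
open scoped TensorProduct

universe u

namespace DingComplex

/-- A semidualizing module `C` over a commutative ring `R`. -/
structure IsSemidualizing {R : Type u} [CommRing R] (C : ModuleCat.{u} R) : Prop where
  /-- `C` has a projective resolution by finitely generated projective modules. -/
  exists_finite_resolution :
    ∃ P : ProjectiveResolution C, ∀ n : ℕ, Module.Finite R (P.complex.X n)
  /-- The homothety map `R → Hom_R(C, C)`, sending `r` to multiplication by `r`, is bijective. -/
  homothety_bijective : Function.Bijective (LinearMap.lsmul R C)
  /-- `Ext^i_R(C, C) = 0` for all `i ≥ 1`. -/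
  ext_vanishing : ∀ i : ℕ, 1 ≤ i → Subsingleton (Abelian.Ext C C i)

/-- The class of projective `R`-modules. -/
def projectiveModules (R : Type u) [CommRing R] : ObjectProperty (ModuleCat.{u} R) :=
  fun M => Module.Projective R M

/-- The class of `C`-projective modules: those isomorphic to `C ⊗ P` with `P` projective. -/
def cProjectiveModules {R : Type u} [CommRing R] (C : ModuleCat.{u} R) :
    ObjectProperty (ModuleCat.{u} R) :=
  fun M => ∃ P : ModuleCat.{u} R, Module.Projective R P ∧ Nonempty (M ≃ₗ[R] (C ⊗[R] P))

/-- The class of `C`-flat modules: those isomorphic to `C ⊗ F` with `F` flat. -/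
def cFlatModules {R : Type u} [CommRing R] (C : ModuleCat.{u} R) :
    ObjectProperty (ModuleCat.{u} R) :=
  fun M => ∃ F : ModuleCat.{u} R, Module.Flat R F ∧ Nonempty (M ≃ₗ[R] (C ⊗[R] F))

/-- The category `Ch(R)` of (unbounded, homologically graded) complexes of `R`-modules. -/
abbrev Ch (R : Type u) [CommRing R] := ChainComplex (ModuleCat.{u} R) ℤ

/-- For a class `𝒳` of modules, the class of `𝒳`-complexes: exact complexes all of whose
cycle modules belong to `𝒳`. -/
def tilde {R : Type u} [CommRing R] (𝒳 : ObjectProperty (ModuleCat.{u} R)) :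
    ObjectProperty (Ch R) :=
  fun X => X.Acyclic ∧ ∀ i : ℤ, 𝒳 (X.cycles i)

/-- A doubly infinite sequence `L` is `Hom(-, ℬ)`-exact if for every `B` in `ℬ` the sequence
`⋯ ⟶ Hom(L_{n-1}, B) ⟶ Hom(L_n, B) ⟶ Hom(L_{n+1}, B) ⟶ ⋯` is exact at every term. -/
def IsHomExact {𝒜 : Type*} [Category 𝒜] [Abelian 𝒜] (L : ChainComplex 𝒜 ℤ)
    (ℬ : ObjectProperty 𝒜) : Prop :=
  ∀ B : 𝒜, ℬ B → ∀ n : ℤ,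
    Function.Exact (fun g : L.X (n - 1) ⟶ B => L.d n (n - 1) ≫ g)
      (fun f : L.X n ⟶ B => L.d (n + 1) n ≫ f)

/-- `D_C`-projective complexes: `X ≅ Im f₀` for some exact sequence of complexes
`⋯ ⟶ E₁ ⟶ E₀ ⟶ E₋₁ ⟶ E₋₂ ⟶ ⋯` with `f₀ : E₀ ⟶ E₋₁`, which remains exact under `Hom(-, H)` for
every `C`-flat complex `H`, where `E_i` is a projective complex for `i ≥ 0` and a `C`-projective
complex for `i < 0`. -/
def IsDCProjective {R : Type u} [CommRing R] (C : ModuleCat.{u} R) (X : Ch R) : Prop :=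
  ∃ E : ChainComplex (Ch R) ℤ,
    E.Acyclic ∧ IsHomExact E (tilde (cFlatModules C)) ∧
    (∀ i : ℤ, 0 ≤ i → tilde (projectiveModules R) (E.X i)) ∧
    (∀ i : ℤ, i < 0 → tilde (cProjectiveModules C) (E.X i)) ∧
    Nonempty (X ≅ Limits.image (E.d 0 (-1)))

end DingComplex

/-!
A complex is `D_C`-projective precisely when it is left `Ext`-orthogonal to all `C`-flat complexes
and has a coresolution by `C`-projective complexes whose cosyzygies are again left orthogonal. By
the horseshoe lemma the class of such complexes is closed under extensions, and therefore an object
that is coresolved by members of the class is itself a member: the coresolution by `C`-projective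
complexes is assembled one cosyzygy at a time by pushouts. Conversely a member `G` of the class is
resolved and coresolved by the trivial sequence `0 ⟶ G = G ⟶ 0`.

The orthogonality of `C`-projective to `C`-flat complexes comes from modules: a `C`-projective
complex is a sum of disks on `C`-projective modules, because the extensions between its cycles
split. For modules, `Ext` vanishing passes from `(C, C)` to `(C, C ⊗ F)` by the tensor evaluation
isomorphism for finitely presented modules, and from `(C, C ⊗ F)` to `(C ⊗ P, C ⊗ F)` by the
projectivity of `P`.
-/

namespace DingComplex

open Limits Abelian

universe w w'

variable {𝒜 : Type*} [Category* 𝒜] [Abelian 𝒜]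

section ShortExact

lemma shortExact_of_exists_desc {A B D : 𝒜} (i : A ⟶ B) (p : B ⟶ D) (w : i ≫ p = 0)
    [Mono i] [Epi p] (hdesc : ∀ {T : 𝒜} (k : B ⟶ T), i ≫ k = 0 → ∃ l : D ⟶ T, p ≫ l = k) :
    (ShortComplex.mk i p w).ShortExact where
  exact := ShortComplex.exact_of_g_is_cokernel _
    (CokernelCofork.IsColimit.ofπ' p w fun k hk => ⟨(hdesc k hk).choose, (hdesc k hk).choose_spec⟩)

lemma exists_desc_of_shortExact {A B D T : 𝒜} {i : A ⟶ B} {p : B ⟶ D} {w : i ≫ p = 0}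
    (h : (ShortComplex.mk i p w).ShortExact) (k : B ⟶ T) (hk : i ≫ k = 0) :
    ∃ l : D ⟶ T, p ≫ l = k :=
  let l := CokernelCofork.IsColimit.desc' h.gIsCokernel k hk
  ⟨l.1, l.2⟩

lemma shortExact_pushout {A B D G : 𝒜} {i : A ⟶ B} {p : B ⟶ D} {w : i ≫ p = 0}
    (h : (ShortComplex.mk i p w).ShortExact) (j : A ⟶ G) :
    (ShortComplex.mk (pushout.inl j i) (pushout.desc 0 p (by simp [w]))
      (pushout.inl_desc _ _ _)).ShortExact := by
  have : Mono i := h.mono_f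
  have : Epi p := h.epi_g
  have : Epi (pushout.desc (0 : G ⟶ D) p (by simp [w] : j ≫ 0 = i ≫ p)) :=
    epi_of_epi_fac (pushout.inr_desc _ _ _)
  refine shortExact_of_exists_desc _ _ _ fun k hk => ?_
  obtain ⟨l, hl⟩ := exists_desc_of_shortExact h (pushout.inr j i ≫ k)
    (by rw [← pushout.condition_assoc, hk, comp_zero])
  exact ⟨l, pushout.hom_ext (by rw [pushout.inl_desc_assoc, zero_comp, hk])
    (by rw [pushout.inr_desc_assoc, hl])⟩

lemma shortExact_biprod {A B D A' B' D' : 𝒜} {i : A ⟶ B} {p : B ⟶ D} {w : i ≫ p = 0}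
    {i' : A' ⟶ B'} {p' : B' ⟶ D'} {w' : i' ≫ p' = 0}
    (h : (ShortComplex.mk i p w).ShortExact) (h' : (ShortComplex.mk i' p' w').ShortExact) :
    (ShortComplex.mk (biprod.map i i') (biprod.map p p')
      (by ext <;> simp [w, w'])).ShortExact := by
  have : Mono i := h.mono_f
  have : Mono i' := h'.mono_f
  have : Epi p := h.epi_g
  have : Epi p' := h'.epi_g
  refine shortExact_of_exists_desc _ _ _ fun k hk => ?_
  obtain ⟨l, hl⟩ := exists_desc_of_shortExact h (biprod.inl ≫ k)
    (by simpa using biprod.inl ≫= hk)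
  obtain ⟨l', hl'⟩ := exists_desc_of_shortExact h' (biprod.inr ≫ k)
    (by simpa using biprod.inr ≫= hk)
  exact ⟨biprod.desc l l', biprod.hom_ext' _ _ (by simp [hl]) (by simp [hl'])⟩

/-- There is a short exact sequence `0 ⟶ A ⟶ B ⟶ D ⟶ 0`. Constructions in which only the objects
matter are phrased with this predicate, whose maps are not part of the data. -/
def HasSES (A B D : 𝒜) : Prop :=
  ∃ (i : A ⟶ B) (p : B ⟶ D) (w : i ≫ p = 0), (ShortComplex.mk i p w).ShortExact

namespace HasSES

lemma of_shortExact {S : ShortComplex 𝒜} (hS : S.ShortExact) : HasSES S.X₁ S.X₂ S.X₃ :=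
  ⟨S.f, S.g, S.zero, hS⟩

lemma of_isZero_left {Z X Y : 𝒜} (hZ : IsZero Z) (e : X ≅ Y) : HasSES Z X Y :=
  of_shortExact (ShortComplex.Splitting.ofIsZeroOfIsIso
    (ShortComplex.mk (0 : Z ⟶ X) e.hom zero_comp) hZ inferInstance).shortExact

lemma of_isZero_right {X Y Z : 𝒜} (e : X ≅ Y) (hZ : IsZero Z) : HasSES X Y Z :=
  of_shortExact (ShortComplex.Splitting.ofIsIsoOfIsZero
    (ShortComplex.mk e.hom (0 : Y ⟶ Z) comp_zero) inferInstance hZ).shortExact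

lemma of_epi {A B : 𝒜} (p : A ⟶ B) [Epi p] : HasSES (kernel p) A B :=
  of_shortExact { exact := ShortComplex.exact_kernel p }

variable {A B D : 𝒜}

lemma of_iso {A' B' D' : 𝒜} (h : HasSES A B D) (a : A ≅ A') (b : B ≅ B') (d : D ≅ D') :
    HasSES A' B' D' := by
  obtain ⟨i, p, w, h⟩ := h
  exact ⟨a.inv ≫ i ≫ b.hom, b.inv ≫ p ≫ d.hom, by simp [reassoc_of% w],
    ShortComplex.shortExact_of_iso (ShortComplex.isoMk a b d) h⟩

lemma biprod_left (G : 𝒜) (h : HasSES A B D) : HasSES (G ⊞ A) (G ⊞ B) D := by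
  obtain ⟨_, _, _, hG⟩ := of_isZero_right (Iso.refl G) (isZero_zero 𝒜)
  obtain ⟨_, _, _, h⟩ := h
  exact (of_shortExact (shortExact_biprod hG h)).of_iso (Iso.refl _) (Iso.refl _)
    (isoZeroBiprod (isZero_zero 𝒜)).symm

lemma exists_pushout {G K : 𝒜} (h₁ : HasSES A B D) (h₂ : HasSES A G K) :
    ∃ W, HasSES G W D ∧ HasSES B W K := by
  obtain ⟨i, _, _, h⟩ := h₁
  obtain ⟨j, _, _, h'⟩ := h₂
  exact ⟨pushout j i, of_shortExact (shortExact_pushout h j),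
    (of_shortExact (shortExact_pushout h' i)).of_iso (Iso.refl _) (pushoutSymmetry i j)
      (Iso.refl _)⟩

lemma exists_quotient {Q E : 𝒜} (h₁ : HasSES A B D) (h₂ : HasSES B Q E) :
    ∃ Y, HasSES A Q Y ∧ HasSES D Y E := by
  obtain ⟨f, g, w, h⟩ := h₁
  obtain ⟨i, _, _, h'⟩ := h₂
  have : Mono f := h.mono_f
  have : Epi g := h.epi_g
  have : Mono i := h'.mono_f
  refine ⟨pushout g i, ⟨f ≫ i, pushout.inr g i, ?_, shortExact_of_exists_desc _ _ _ ?_⟩,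
    of_shortExact (shortExact_pushout h' g)⟩
  · rw [Category.assoc, ← pushout.condition, reassoc_of% w, zero_comp]
  · intro T k hk
    obtain ⟨l, hl⟩ := exists_desc_of_shortExact h (i ≫ k) (by simpa using hk)
    exact ⟨pushout.desc l k hl, pushout.inr_desc _ _ _⟩

end HasSES

end ShortExact

section Ext

variable [HasExt.{w} 𝒜]

/-- `Ext^i(X, Y) = 0` for all `i ≥ 1`. -/
def ExtOrthogonal (X Y : 𝒜) : Prop := ∀ i : ℕ, Subsingleton (Ext X Y (i + 1))

/-- The left orthogonal class `^⊥ℬ`: the objects `X` with `Ext^i(X, B) = 0` for all `i ≥ 1` and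
all `B` in `ℬ`. -/
def leftExtOrthogonal (ℬ : ObjectProperty 𝒜) : ObjectProperty 𝒜 :=
  fun X => ∀ B, ℬ B → ExtOrthogonal X B

lemma exists_extension_of_subsingleton_ext_one {A B D Y : 𝒜} {i : A ⟶ B} {p : B ⟶ D}
    {w : i ≫ p = 0} (h : (ShortComplex.mk i p w).ShortExact) (hD : Subsingleton (Ext D Y 1))
    (f : A ⟶ Y) : ∃ g : B ⟶ Y, i ≫ g = f := by
  obtain ⟨x, hx⟩ := Ext.contravariant_sequence_exact₁ h Y (Ext.mk₀ f) (n₁ := 1) rfl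
    (Subsingleton.elim _ _)
  obtain ⟨g, rfl⟩ := Ext.addEquiv₀.symm.surjective x
  exact ⟨g, Ext.addEquiv₀.symm.injective (by simpa using hx)⟩

lemma subsingleton_ext_one_of_exists_extension {A B D Y : 𝒜} {i : A ⟶ B} {p : B ⟶ D}
    {w : i ≫ p = 0} (h : (ShortComplex.mk i p w).ShortExact) (hB : Subsingleton (Ext B Y 1))
    (hext : ∀ f : A ⟶ Y, ∃ g : B ⟶ Y, i ≫ g = f) : Subsingleton (Ext D Y 1) := by
  refine subsingleton_of_forall_eq 0 fun x => ?_
  obtain ⟨y, rfl⟩ := Ext.contravariant_sequence_exact₃ h Y x (Subsingleton.elim _ _)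
    (n₀ := 0) rfl
  obtain ⟨f, rfl⟩ := Ext.addEquiv₀.symm.surjective y
  obtain ⟨g, rfl⟩ := hext f
  rw [Ext.addEquiv₀_symm_apply, ← Ext.mk₀_comp_mk₀, h.extClass_comp_assoc]

namespace HasSES

variable {A B D X Y : 𝒜}

lemma subsingleton_ext_left (h : HasSES A B D) {n : ℕ}
    (hB : Subsingleton (Ext B Y n)) (hD : Subsingleton (Ext D Y (n + 1))) :
    Subsingleton (Ext A Y n) := by
  obtain ⟨_, _, _, h⟩ := h
  refine subsingleton_of_forall_eq 0 fun x => ?_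
  obtain ⟨y, rfl⟩ := Ext.contravariant_sequence_exact₁ h Y x (add_comm 1 n)
    (Subsingleton.elim _ _)
  rw [Subsingleton.elim y 0, Ext.comp_zero]

lemma subsingleton_ext_middle (h : HasSES A B D) {n : ℕ}
    (hA : Subsingleton (Ext A Y n)) (hD : Subsingleton (Ext D Y n)) :
    Subsingleton (Ext B Y n) := by
  obtain ⟨_, _, _, h⟩ := h
  refine subsingleton_of_forall_eq 0 fun x => ?_
  obtain ⟨y, rfl⟩ := Ext.contravariant_sequence_exact₂ h Y x (Subsingleton.elim _ _)
  rw [Subsingleton.elim y 0, Ext.comp_zero]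

lemma subsingleton_ext_right (h : HasSES A B D) {n : ℕ}
    (hA : Subsingleton (Ext A Y n)) (hB : Subsingleton (Ext B Y (n + 1))) :
    Subsingleton (Ext D Y (n + 1)) := by
  obtain ⟨_, _, _, h⟩ := h
  refine subsingleton_of_forall_eq 0 fun x => ?_
  obtain ⟨y, rfl⟩ := Ext.contravariant_sequence_exact₃ h Y x (Subsingleton.elim _ _)
    (add_comm 1 n)
  rw [Subsingleton.elim y 0, Ext.comp_zero]

lemma extOrthogonal_target_middle (h : HasSES A B D) (hA : ExtOrthogonal X A)
    (hD : ExtOrthogonal X D) : ExtOrthogonal X B := by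
  obtain ⟨_, _, _, h⟩ := h
  refine fun i => subsingleton_of_forall_eq 0 fun x => ?_
  have := hA i
  have := hD i
  obtain ⟨y, rfl⟩ := Ext.covariant_sequence_exact₂ _ h x (Subsingleton.elim _ _)
  rw [Subsingleton.elim y 0, Ext.zero_comp]

lemma extOrthogonal_left (h : HasSES A B D) (hB : ExtOrthogonal B Y) (hD : ExtOrthogonal D Y) :
    ExtOrthogonal A Y :=
  fun i => h.subsingleton_ext_left (hB i) (hD (i + 1))

lemma nonempty_iso_biprod (h : HasSES A B D) (hDA : Subsingleton (Ext D A 1)) :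
    Nonempty (B ≅ A ⊞ D) := by
  obtain ⟨i, p, w, h⟩ := h
  obtain ⟨r, hr⟩ := exists_extension_of_subsingleton_ext_one h hDA (𝟙 A)
  exact ⟨(ShortComplex.Splitting.ofExactOfRetraction _ h.exact r hr h.epi_g).isoBinaryBiproduct⟩

end HasSES

lemma extOrthogonal_of_projective (P Y : 𝒜) [Projective P] : ExtOrthogonal P Y :=
  fun _ => Ext.subsingleton_of_projective _ _ _

lemma extOrthogonal_of_isZero {Z : 𝒜} (hZ : IsZero Z) (Y : 𝒜) : ExtOrthogonal Z Y :=
  have : Projective Z := ⟨fun _ _ _ => ⟨0, hZ.eq_of_src _ _⟩⟩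
  extOrthogonal_of_projective Z Y

lemma ExtOrthogonal.of_iso {X X' Y Y' : 𝒜} (h : ExtOrthogonal X Y) (e : X ≅ X') (f : Y ≅ Y') :
    ExtOrthogonal X' Y' := by
  refine fun i => subsingleton_of_forall_eq 0 fun x => ?_
  have := h i
  calc x = ((Ext.mk₀ e.inv).comp (((Ext.mk₀ e.hom).comp x (zero_add _)).comp
        (Ext.mk₀ f.inv) (add_zero _)) (zero_add _)).comp (Ext.mk₀ f.hom) (add_zero _) := by simp
    _ = 0 := by
      rw [Subsingleton.elim (((Ext.mk₀ e.hom).comp x (zero_add _)).comp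
        (Ext.mk₀ f.inv) (add_zero _)) 0, Ext.comp_zero, Ext.zero_comp]

instance (ℬ : ObjectProperty 𝒜) : (leftExtOrthogonal ℬ).ContainsZero where
  exists_zero := ⟨_, isZero_zero 𝒜, fun Y _ => extOrthogonal_of_isZero (isZero_zero 𝒜) Y⟩

instance (ℬ : ObjectProperty 𝒜) : (leftExtOrthogonal ℬ).IsClosedUnderExtensions where
  prop_X₂_of_shortExact hS h₁ h₃ Y hY i :=
    (HasSES.of_shortExact hS).subsingleton_ext_middle (h₁ Y hY i) (h₃ Y hY i)

instance (ℬ : ObjectProperty 𝒜) : (leftExtOrthogonal ℬ).IsClosedUnderIsomorphisms where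
  of_iso e hX Y hY := (hX Y hY).of_iso e (Iso.refl Y)

theorem extOrthogonal_of_syzygies (𝒮 : ObjectProperty 𝒜) {Y : 𝒜}
    (ext_one : ∀ X, 𝒮 X → Subsingleton (Ext X Y 1))
    (exists_syzygy : ∀ X, 𝒮 X → ∃ K E, 𝒮 K ∧ ExtOrthogonal E Y ∧ HasSES K E X)
    {X : 𝒜} (hX : 𝒮 X) : ExtOrthogonal X Y := by
  intro i
  induction i generalizing X with
  | zero => exact ext_one X hX
  | succ i ih =>
    obtain ⟨K, E, hK, hE, h⟩ := exists_syzygy X hX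
    exact h.subsingleton_ext_right (ih hK) (hE (i + 1))

end Ext

section Coresolved

/-- The largest class `𝒮 ⊆ 𝒱` such that every `X` in `𝒮` sits in a short exact sequence
`0 ⟶ X ⟶ Q ⟶ Y ⟶ 0` with `Q` in `𝒬` and `Y` in `𝒮`; that is, the objects with a coresolution
`0 ⟶ X ⟶ Q₋₁ ⟶ Q₋₂ ⟶ ⋯` by objects of `𝒬` whose cosyzygies lie in `𝒱`. Describing it as a union
of classes lets membership be proved by coinduction, without constructing the coresolution. -/
def coresolved (𝒱 𝒬 : ObjectProperty 𝒜) : ObjectProperty 𝒜 := fun X =>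
  ∃ 𝒮 : ObjectProperty 𝒜, 𝒮 X ∧ ∀ X, 𝒮 X → 𝒱 X ∧ ∃ Q Y, 𝒬 Q ∧ 𝒮 Y ∧ HasSES X Q Y

variable {𝒱 𝒬 : ObjectProperty 𝒜}

lemma le_coresolved {𝒮 : ObjectProperty 𝒜} (mem : 𝒮 ≤ 𝒱)
    (exists_cosyzygy : ∀ X, 𝒮 X → ∃ Q Y, 𝒬 Q ∧ 𝒮 Y ∧ HasSES X Q Y) : 𝒮 ≤ coresolved 𝒱 𝒬 :=
  fun _ hX => ⟨𝒮, hX, fun X hX => ⟨mem X hX, exists_cosyzygy X hX⟩⟩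

lemma coresolved_le : coresolved 𝒱 𝒬 ≤ 𝒱 :=
  fun X ⟨_, hX, h⟩ => (h X hX).1

lemma coresolved.exists_hasSES {X : 𝒜} (h : coresolved 𝒱 𝒬 X) :
    ∃ Q Y, 𝒬 Q ∧ coresolved 𝒱 𝒬 Y ∧ HasSES X Q Y :=
  let ⟨𝒮, hX, h⟩ := h
  let ⟨Q, Y, hQ, hY, e⟩ := (h X hX).2
  ⟨Q, Y, hQ, ⟨𝒮, hY, h⟩, e⟩

instance [𝒱.ContainsZero] [𝒬.ContainsZero] : (coresolved 𝒱 𝒬).ContainsZero where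
  exists_zero := by
    obtain ⟨V, hV, h𝒱⟩ := 𝒱.exists_prop_of_containsZero
    obtain ⟨Q, hQ, h𝒬⟩ := 𝒬.exists_prop_of_containsZero
    refine ⟨V, hV, le_coresolved (𝒮 := fun X => X = V) ?_ ?_ V rfl⟩
    · rintro _ rfl
      exact h𝒱
    · rintro _ rfl
      exact ⟨Q, _, h𝒬, rfl, HasSES.of_isZero_left hV (hQ.iso hV)⟩

variable [HasExt.{w} 𝒜] [𝒱.IsClosedUnderExtensions]
  (ext_one : ∀ V Q, 𝒱 V → 𝒬 Q → Subsingleton (Ext V Q 1))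
  (biprod : ∀ Q Q', 𝒬 Q → 𝒬 Q' → 𝒬 (Q ⊞ Q'))

include ext_one biprod

/-- The horseshoe argument: pushing `A ⟶ B` out along `A ⟶ Q_A` gives an extension of `D` by `Q_A`,
which splits. -/
theorem coresolved_of_hasSES {A B D : 𝒜} (h : HasSES A B D) (hA : coresolved 𝒱 𝒬 A)
    (hD : coresolved 𝒱 𝒬 D) : coresolved 𝒱 𝒬 B := by
  refine le_coresolved (𝒮 := fun B => ∃ A D, HasSES A B D ∧ coresolved 𝒱 𝒬 A ∧ coresolved 𝒱 𝒬 D)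
    ?_ ?_ B ⟨A, D, h, hA, hD⟩
  · rintro B ⟨A, D, ⟨_, _, _, h⟩, hA, hD⟩
    exact 𝒱.prop_X₂_of_shortExact h (coresolved_le A hA) (coresolved_le D hD)
  · rintro B ⟨A, D, h, hA, hD⟩
    obtain ⟨QA, A', hQA, hA', sA⟩ := hA.exists_hasSES
    obtain ⟨QD, D', hQD, hD', sD⟩ := hD.exists_hasSES
    obtain ⟨B₁, h₁, h₂⟩ := h.exists_pushout sA
    obtain ⟨e⟩ := h₁.nonempty_iso_biprod (ext_one D QA (coresolved_le D hD) hQA)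
    obtain ⟨B', h₃, h₄⟩ := (h₂.of_iso (Iso.refl _) e (Iso.refl _)).exists_quotient
      (sD.biprod_left QA)
    exact ⟨QA ⊞ QD, B', biprod _ _ hQA hQD, ⟨A', D', h₄, hA', hD'⟩, h₃⟩

/-- Coinduction on the extensions `0 ⟶ K ⟶ Y ⟶ G ⟶ 0` of objects `G` coresolved by `𝒬` by objects
`K` coresolved by `coresolved 𝒱 𝒬`: a cosyzygy step for `K` turns `Y` into a subobject of an
extension `W` of objects coresolved by `𝒬`, and a cosyzygy step for `W` then does it for `Y`. -/
theorem coresolved_coresolved_le [𝒱.ContainsZero] [𝒬.ContainsZero] :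
    coresolved 𝒱 (coresolved 𝒱 𝒬) ≤ coresolved 𝒱 𝒬 := by
  have hle : (fun Y => ∃ K G, HasSES K Y G ∧ coresolved 𝒱 (coresolved 𝒱 𝒬) K ∧
      coresolved 𝒱 𝒬 G : ObjectProperty 𝒜) ≤ coresolved 𝒱 𝒬 := by
    refine le_coresolved ?_ ?_
    · rintro Y ⟨K, G, ⟨_, _, _, h⟩, hK, hG⟩
      exact 𝒱.prop_X₂_of_shortExact h (coresolved_le K hK) (coresolved_le G hG)
    · rintro Y ⟨K, G, h, hK, hG⟩
      obtain ⟨H, K', hH, hK', s⟩ := hK.exists_hasSES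
      obtain ⟨W, h₁, h₂⟩ := h.exists_pushout s
      obtain ⟨Q, W', hQ, hW', s'⟩ := (coresolved_of_hasSES ext_one biprod h₁ hH hG).exists_hasSES
      obtain ⟨Y', h₃, h₄⟩ := h₂.exists_quotient s'
      exact ⟨Q, Y', hQ, ⟨K', W', h₄, hK', hW'⟩, h₃⟩
  obtain ⟨Z, hZ, hZ𝒬⟩ := (coresolved 𝒱 𝒬).exists_prop_of_containsZero
  exact fun X hX => hle X ⟨X, Z, HasSES.of_isZero_right (Iso.refl X) hZ, hX, hZ𝒬⟩

end Coresolved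

section Splice

lemma shortExact_opcycles {κ : Type*} {c : ComplexShape κ} (K : HomologicalComplex 𝒜 c)
    {i j : κ} (hij : c.Rel i j) (hK : K.ExactAt i) :
    (ShortComplex.mk (K.fromOpcycles i j) (K.pOpcycles j) (by
      rw [← cancel_epi (K.pOpcycles i), K.p_fromOpcycles_assoc, K.d_pOpcycles,
        comp_zero])).ShortExact := by
  have : Mono (K.fromOpcycles i j) :=
    Preadditive.mono_of_isZero_kernel' _ (K.homologyIsKernel i j (c.next_eq' hij))
      hK.isZero_homology
  refine shortExact_of_exists_desc _ _ _ fun k hk =>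
    ⟨K.descOpcycles k i (c.prev_eq' hij) ?_, K.p_descOpcycles _ _ _ _⟩
  rw [← K.p_fromOpcycles, Category.assoc, hk, comp_zero]

lemma hasSES_opcycles (K : ChainComplex 𝒜 ℤ) (hK : K.Acyclic) (n : ℤ) :
    HasSES (K.opcycles (n + 1)) (K.X n) (K.opcycles n) :=
  HasSES.of_shortExact (shortExact_opcycles K (c := ComplexShape.down ℤ) rfl (hK (n + 1)))

/-- For an acyclic complex, the opcycles are the images of the differentials. -/
noncomputable def opcyclesIsoImage (K : ChainComplex 𝒜 ℤ) (hK : K.Acyclic) {i j : ℤ}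
    (hij : j + 1 = i) : K.opcycles i ≅ image (K.d i j) :=
  have := (shortExact_opcycles K (c := ComplexShape.down ℤ) hij (hK i)).mono_f
  have := strongEpi_of_epi (K.pOpcycles i)
  image.isoStrongEpiMono (K.pOpcycles i) (K.fromOpcycles i j) (K.p_fromOpcycles i j)

/-- The opcycles are the cokernels of the differentials. -/
noncomputable def opcyclesIsoCokernel (K : ChainComplex 𝒜 ℤ) {i j : ℤ} (hij : j + 1 = i) :
    K.opcycles j ≅ cokernel (K.d i j) :=
  (K.opcyclesIsCokernel i j (by simpa using hij)).coconePointUniqueUpToIso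
    (colimit.isColimit (parallelPair (K.d i j) 0))

section

variable {K : ChainComplex 𝒜 ℤ} {Z : ℤ → 𝒜} {i : ∀ n, Z (n + 1) ⟶ K.X n}
  {p : ∀ n, K.X n ⟶ Z n} {w : ∀ n, i n ≫ p n = 0}
  (h : ∀ n, (ShortComplex.mk (i n) (p n) (w n)).ShortExact)
  (hd : ∀ n, K.d (n + 1) n = p (n + 1) ≫ i n)

include h hd

lemma acyclic_of_splicing : K.Acyclic := by
  intro m
  obtain ⟨n, rfl⟩ : ∃ n, m = n + 1 := ⟨m - 1, by ring⟩
  have : Epi (p (n + 1 + 1)) := (h _).epi_g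
  have : Mono (i n) := (h n).mono_f
  have : Mono (i (n + 1)) := (h _).mono_f
  rw [HomologicalComplex.exactAt_iff' _ (n + 1 + 1) (n + 1) n (by simp) (by simp),
    ShortComplex.exact_iff_exact_up_to_refinements]
  intro A (x : A ⟶ K.X (n + 1)) (hx : x ≫ K.d (n + 1) n = 0)
  have hxp : x ≫ p (n + 1) = 0 := by rwa [← cancel_mono (i n), Category.assoc, ← hd, zero_comp]
  obtain ⟨A', π, hπ, y, hy⟩ := surjective_up_to_refinements_of_epi (p (n + 1 + 1))
    ((h (n + 1)).exact.lift x hxp)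
  refine ⟨A', π, hπ, y, ?_⟩
  change π ≫ x = y ≫ K.d (n + 1 + 1) (n + 1)
  calc π ≫ x = (π ≫ (h (n + 1)).exact.lift x hxp) ≫ i (n + 1) := by
        rw [Category.assoc, (h (n + 1)).exact.lift_f]
    _ = y ≫ K.d (n + 1 + 1) (n + 1) := by rw [hy, hd, Category.assoc]

/-- The opcycles of a complex spliced from short exact sequences `0 ⟶ Z (n + 1) ⟶ K n ⟶ Z n ⟶ 0`. -/
noncomputable def opcyclesIsoOfSplicing (n : ℤ) : K.opcycles n ≅ Z n :=
  have : Epi (p n) := (h n).epi_g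
  have : Epi (p (n + 1)) := (h (n + 1)).epi_g
  have hdp : K.d (n + 1) n ≫ p n = 0 := by rw [hd, Category.assoc, w, comp_zero]
  have hdesc {T : 𝒜} (k : K.X n ⟶ T) (hk : K.d (n + 1) n ≫ k = 0) : ∃ l, p n ≫ l = k :=
    exists_desc_of_shortExact (h n) k
      (by rwa [← cancel_epi (p (n + 1)), comp_zero, ← Category.assoc, ← hd])
  (K.opcyclesIsCokernel (n + 1) n (by simp)).coconePointUniqueUpToIso
    (CokernelCofork.IsColimit.ofπ' (p n) hdp fun k hk =>
      ⟨(hdesc k hk).choose, (hdesc k hk).choose_spec⟩)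

end

lemma exists_acyclic_of_hasSES (Z E : ℤ → 𝒜) (h : ∀ n, HasSES (Z (n + 1)) (E n) (Z n)) :
    ∃ K : ChainComplex 𝒜 ℤ, K.Acyclic ∧ K.X = E ∧ ∀ n, Nonempty (K.opcycles n ≅ Z n) := by
  choose i p w h using h
  let K := ChainComplex.of E (fun n => p (n + 1) ≫ i n) fun n => by simp [reassoc_of% w]
  have hd (n : ℤ) : K.d (n + 1) n = p (n + 1) ≫ i n :=
    ChainComplex.of_d E (fun n => p (n + 1) ≫ i n) n
  exact ⟨K, acyclic_of_splicing (K := K) h hd, rfl,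
    fun n => ⟨opcyclesIsoOfSplicing (K := K) h hd n⟩⟩

lemma isHomExact_iff (K : ChainComplex 𝒜 ℤ) (ℬ : ObjectProperty 𝒜) :
    IsHomExact K ℬ ↔ ∀ B, ℬ B → ∀ i j, j + 1 = i → ∀ f : K.opcycles i ⟶ B,
      ∃ g : K.X j ⟶ B, K.fromOpcycles i j ≫ g = f := by
  refine forall₂_congr fun B _ => ⟨fun H i j hij f => ?_, fun H n f => ⟨fun hf => ?_, ?_⟩⟩
  · obtain rfl : j = i - 1 := by lia
    obtain ⟨g, hg⟩ := (H i (K.pOpcycles i ≫ f)).1 (by simp)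
    exact ⟨g, by simpa only [← cancel_epi (K.pOpcycles i), K.p_fromOpcycles_assoc] using hg⟩
  · obtain ⟨g, hg⟩ := H n (n - 1) (by ring) (K.descOpcycles f (n + 1) (by simp) hf)
    exact ⟨g, by simp only [← K.p_fromOpcycles, Category.assoc, hg, K.p_descOpcycles]⟩
  · rintro ⟨g, rfl⟩
    simp

section

variable [HasExt.{w} 𝒜] {ℬ : ObjectProperty 𝒜} {K : ChainComplex 𝒜 ℤ} (hK : K.Acyclic)

include hK

lemma isHomExact_of_leftExtOrthogonal_opcycles (h : ∀ n, leftExtOrthogonal ℬ (K.opcycles n)) :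
    IsHomExact K ℬ := by
  rw [isHomExact_iff]
  intro B hB i j hij f
  exact exists_extension_of_subsingleton_ext_one
    (shortExact_opcycles K (c := ComplexShape.down ℤ) hij (hK i)) (h j B hB 0) f

lemma leftExtOrthogonal_opcycles (hHom : IsHomExact K ℬ) (h : ∀ n, leftExtOrthogonal ℬ (K.X n))
    (n : ℤ) : leftExtOrthogonal ℬ (K.opcycles n) := by
  intro B hB
  refine extOrthogonal_of_syzygies (fun X => ∃ n, X = K.opcycles n) ?_ ?_ ⟨n, rfl⟩
  · rintro _ ⟨n, rfl⟩
    exact subsingleton_ext_one_of_exists_extension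
      (shortExact_opcycles K (c := ComplexShape.down ℤ) rfl (hK (n + 1))) (h n B hB 0)
      ((isHomExact_iff K ℬ).1 hHom B hB (n + 1) n rfl)
  · rintro _ ⟨n, rfl⟩
    exact ⟨_, K.X n, ⟨n + 1, rfl⟩, h n B hB, hasSES_opcycles K hK n⟩

end

end Splice

section CompleteResolution

/-- `X` is the cokernel of `E 1 ⟶ E 0` (equivalently the image of `E 0 ⟶ E (-1)`) in an acyclic
`Hom(-, ℬ)`-exact complex `E` with terms in `𝒯` in degrees `≥ 0` and in `𝒬` in degrees `< 0`. -/
def HasCompleteResolution (ℬ 𝒯 𝒬 : ObjectProperty 𝒜) (X : 𝒜) : Prop :=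
  ∃ E : ChainComplex 𝒜 ℤ, E.Acyclic ∧ IsHomExact E ℬ ∧ (∀ n, 0 ≤ n → 𝒯 (E.X n)) ∧
    (∀ n, n < 0 → 𝒬 (E.X n)) ∧ Nonempty (X ≅ E.opcycles 0)

lemma hasCompleteResolution_self_iff {ℬ 𝒢 : ObjectProperty 𝒜} {X : 𝒜} :
    HasCompleteResolution ℬ 𝒢 𝒢 X ↔ ∃ G : ChainComplex 𝒜 ℤ, G.Acyclic ∧ IsHomExact G ℬ ∧
      (∀ n, 𝒢 (G.X n)) ∧ Nonempty (X ≅ cokernel (G.d 1 0)) := by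
  constructor
  · rintro ⟨G, hG, hHom, h₀, h₁, ⟨e⟩⟩
    exact ⟨G, hG, hHom, fun n => (le_or_gt 0 n).elim (h₀ n) (h₁ n),
      ⟨e ≪≫ opcyclesIsoCokernel G (zero_add 1)⟩⟩
  · rintro ⟨G, hG, hHom, h, ⟨e⟩⟩
    exact ⟨G, hG, hHom, fun n _ => h n, fun n _ => h n,
      ⟨e ≪≫ (opcyclesIsoCokernel G (zero_add 1)).symm⟩⟩

variable [HasExt.{w} 𝒜] {ℬ 𝒯 𝒬 : ObjectProperty 𝒜}

theorem HasCompleteResolution.coresolved (h𝒯 : 𝒯 ≤ leftExtOrthogonal ℬ)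
    (h𝒬 : 𝒬 ≤ leftExtOrthogonal ℬ) {X : 𝒜} (hX : HasCompleteResolution ℬ 𝒯 𝒬 X) :
    coresolved (leftExtOrthogonal ℬ) 𝒬 X := by
  obtain ⟨E, hE, hHom, hE𝒯, hE𝒬, ⟨e⟩⟩ := hX
  have hX (n : ℤ) : leftExtOrthogonal ℬ (E.X n) :=
    (le_or_gt 0 n).elim (fun hn => h𝒯 _ (hE𝒯 n hn)) (fun hn => h𝒬 _ (hE𝒬 n hn))
  refine le_coresolved (𝒮 := fun Y => ∃ n ≤ 0, Nonempty (E.opcycles n ≅ Y)) ?_ ?_ X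
    ⟨0, le_rfl, ⟨e.symm⟩⟩
  · rintro Y ⟨n, -, ⟨e⟩⟩
    exact (leftExtOrthogonal ℬ).prop_of_iso e (leftExtOrthogonal_opcycles hE hHom hX n)
  · rintro Y ⟨m, hm, ⟨e⟩⟩
    obtain ⟨n, rfl⟩ : ∃ n, m = n + 1 := ⟨m - 1, by ring⟩
    exact ⟨E.X n, E.opcycles n, hE𝒬 n (by lia), ⟨n, by lia, ⟨Iso.refl _⟩⟩,
      (hasSES_opcycles E hE n).of_iso e (Iso.refl _) (Iso.refl _)⟩

lemma exists_seq_of_forall_exists_next {α β : Type*} {p : α → Prop} {r : α → β → α → Prop}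
    (next : ∀ a, p a → ∃ b a', p a' ∧ r a b a') {a : α} (ha : p a) :
    ∃ (x : ℕ → α) (y : ℕ → β), x 0 = a ∧ (∀ n, p (x n)) ∧ ∀ n, r (x n) (y n) (x (n + 1)) := by
  choose f g hg hr using next
  let x : ℕ → {a // p a} := fun n => (fun a => ⟨g a a.2, hg a a.2⟩)^[n] ⟨a, ha⟩
  refine ⟨fun n => x n, fun n => f (x n) (x n).2, rfl, fun n => (x n).2, fun n => ?_⟩
  have hx : x (n + 1) = ⟨g (x n) (x n).2, hg _ _⟩ := Function.iterate_succ_apply' _ _ _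
  simpa only [hx] using hr _ _

theorem hasCompleteResolution_of_coresolved {𝒮 : ObjectProperty 𝒜}
    (h𝒮 : 𝒮 ≤ leftExtOrthogonal ℬ) (exists_syzygy : ∀ X, 𝒮 X → ∃ K P, 𝒮 K ∧ 𝒯 P ∧ HasSES K P X)
    {X : 𝒜} (hX𝒮 : 𝒮 X) (hX : coresolved (leftExtOrthogonal ℬ) 𝒬 X) :
    HasCompleteResolution ℬ 𝒯 𝒬 X := by
  obtain ⟨l, P, hl₀, hl, hP⟩ := exists_seq_of_forall_exists_next
    (r := fun X P K => 𝒯 P ∧ HasSES K P X)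
    (fun X hX => let ⟨K, P, hK, h⟩ := exists_syzygy X hX; ⟨P, K, hK, h⟩) hX𝒮
  obtain ⟨r, Q, hr₀, hr, hQ⟩ := exists_seq_of_forall_exists_next
    (r := fun X Q Y => 𝒬 Q ∧ HasSES X Q Y)
    (fun X (hX : coresolved (leftExtOrthogonal ℬ) 𝒬 X) =>
      let ⟨Q, Y, hQ, hY, h⟩ := hX.exists_hasSES; ⟨Q, Y, hY, hQ, h⟩) hX
  let Z : ℤ → 𝒜
    | .ofNat k => l k
    | .negSucc k => r (k + 1)
  have hZ : ∀ n, leftExtOrthogonal ℬ (Z n)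
    | .ofNat k => h𝒮 _ (hl k)
    | .negSucc k => coresolved_le _ (hr (k + 1))
  let E : ℤ → 𝒜
    | .ofNat k => P k
    | .negSucc k => Q k
  have hE : ∀ n, HasSES (Z (n + 1)) (E n) (Z n)
    | .ofNat k => (hP k).2
    | .negSucc 0 => (hQ 0).2.of_iso (eqToIso (hr₀.trans hl₀.symm)) (Iso.refl _) (Iso.refl _)
    | .negSucc (k + 1) => (hQ (k + 1)).2
  obtain ⟨K, hK, hKE, e⟩ := exists_acyclic_of_hasSES Z E hE
  refine ⟨K, hK, isHomExact_of_leftExtOrthogonal_opcycles hK fun n =>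
    (leftExtOrthogonal ℬ).prop_of_iso (e n).some.symm (hZ n), ?_, ?_,
    ⟨eqToIso hl₀.symm ≪≫ (e 0).some.symm⟩⟩
  · rintro (k | k) hk
    · exact hKE ▸ (hP k).1
    · exact absurd hk (by lia)
  · rintro (k | k) hk
    · exact absurd hk (by simp)
    · exact hKE ▸ (hQ k).1

end CompleteResolution

section Disks

/-- The direct sum over `n` of the disks `⋯ ⟶ 0 ⟶ M n = M n ⟶ 0 ⟶ ⋯` in degrees `n` and `n - 1`:
it is `M (n + 1) ⊞ M n` in degree `n`, where the second summand generates the `n`-th disk. -/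
noncomputable abbrev disks (M : ℤ → 𝒜) : ChainComplex 𝒜 ℤ where
  X n := M (n + 1) ⊞ M n
  d i j := if h : i = j + 1 then biprod.snd ≫ eqToHom (congrArg M h) ≫ biprod.inl else 0
  shape i j hij := dif_neg fun h => hij h.symm
  d_comp_d' := by
    rintro _ _ k rfl rfl
    simp

namespace disks

variable {M M' M'' : ℤ → 𝒜} {Y : ChainComplex 𝒜 ℤ}

lemma d_eq (n : ℤ) : (disks M).d (n + 1) n = biprod.snd ≫ biprod.inl := by
  simp

lemma shortExact (n : ℤ) :
    (ShortComplex.mk (biprod.inl : M (n + 1) ⟶ (disks M).X n) biprod.snd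
      biprod.inl_snd).ShortExact :=
  (ShortComplex.Splitting.ofHasBinaryBiproduct _ _).shortExact

lemma acyclic : (disks M).Acyclic :=
  acyclic_of_splicing shortExact d_eq

/-- The opcycles of a sum of disks. -/
noncomputable def opcyclesIso (n : ℤ) : (disks M).opcycles n ≅ M n :=
  opcyclesIsoOfSplicing shortExact d_eq n

/-- The morphism of complexes out of a sum of disks with given values on the generators. -/
@[simps]
noncomputable def desc (φ : ∀ n, M n ⟶ Y.X n) : disks M ⟶ Y where
  f n := biprod.desc (φ (n + 1) ≫ Y.d (n + 1) n) (φ n)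
  comm' := by
    rintro _ j rfl
    ext <;> simp

lemma hom_ext {f g : disks M ⟶ Y} (h : ∀ n, biprod.inr ≫ f.f n = biprod.inr ≫ g.f n) :
    f = g := by
  refine HomologicalComplex.hom_ext _ _ fun n => biprod.hom_ext' _ _ ?_ (h n)
  have inl_eq : biprod.inl = biprod.inr ≫ (disks M).d (n + 1) n := by
    rw [d_eq, biprod.inr_snd_assoc]
  rw [inl_eq, Category.assoc, Category.assoc, ← f.comm, ← g.comm, reassoc_of% h (n + 1)]

instance [∀ n, Projective (M n)] : Projective (disks M) where
  factors f e _ := ⟨desc fun n => Projective.factorThru (biprod.inr ≫ f.f n) (e.f n),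
    hom_ext fun n => by simp⟩

/-- Sums of disks are functorial in the family of objects. -/
@[simps]
noncomputable def map (φ : ∀ n, M n ⟶ M' n) : disks M ⟶ disks M' where
  f n := biprod.map (φ (n + 1)) (φ n)
  comm' := by
    rintro _ j rfl
    ext <;> simp

lemma shortExact_map {i : ∀ n, M n ⟶ M' n} {p : ∀ n, M' n ⟶ M'' n} {w : ∀ n, i n ≫ p n = 0}
    (h : ∀ n, (ShortComplex.mk (i n) (p n) (w n)).ShortExact) :
    (ShortComplex.mk (map i) (map p) (by ext <;> simp [w])).ShortExact :=
  HomologicalComplex.shortExact_of_degreewise_shortExact _ fun n =>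
    shortExact_biprod (h (n + 1)) (h n)

end disks

/-- Morphisms out of `disks M` are families of morphisms out of the `M n`, and disks on projectives
are projective, so the syzygies of `disks M` are the disks on the syzygies of the `M n`. -/
theorem extOrthogonal_disks [EnoughProjectives 𝒜] [HasExt.{w} 𝒜] [HasExt.{w'} (ChainComplex 𝒜 ℤ)]
    {M : ℤ → 𝒜} {Y : ChainComplex 𝒜 ℤ} (h : ∀ n, ExtOrthogonal (M n) (Y.X n)) :
    ExtOrthogonal (disks M) Y := by
  have hπ (M : ℤ → 𝒜) (n : ℤ) : (ShortComplex.mk (kernel.ι (Projective.π (M n)))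
      (Projective.π (M n)) (kernel.condition _)).ShortExact :=
    { exact := ShortComplex.exact_kernel _ }
  refine extOrthogonal_of_syzygies
    (fun K => ∃ M, K = disks M ∧ ∀ n, ExtOrthogonal (M n) (Y.X n)) ?_ ?_ ⟨M, rfl, h⟩
  · rintro _ ⟨M, rfl, h⟩
    refine subsingleton_ext_one_of_exists_extension (disks.shortExact_map (hπ M))
      (extOrthogonal_of_projective _ _ 0) fun f => ?_
    choose g hg using fun n =>
      exists_extension_of_subsingleton_ext_one (hπ M n) (h n 0) (biprod.inr ≫ f.f n)
    exact ⟨disks.desc g, disks.hom_ext fun n => by simp [hg]⟩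
  · rintro _ ⟨M, rfl, h⟩
    exact ⟨_, _, ⟨_, rfl, fun n => (HasSES.of_shortExact (hπ M n)).extOrthogonal_left
      (extOrthogonal_of_projective _ _) (h n)⟩,
      extOrthogonal_of_projective _ _, HasSES.of_shortExact (disks.shortExact_map (hπ M))⟩

theorem nonempty_iso_disks_opcycles [HasExt.{w} 𝒜] {K : ChainComplex 𝒜 ℤ} (hK : K.Acyclic)
    (h : ∀ n, Subsingleton (Ext (K.opcycles n) (K.opcycles (n + 1)) 1)) :
    Nonempty (K ≅ disks fun n => K.opcycles n) := by
  have hS (n : ℤ) := shortExact_opcycles K (c := ComplexShape.down ℤ) (i := n + 1) rfl (hK (n + 1))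
  choose r hr using fun n => exists_extension_of_subsingleton_ext_one (hS n) (h n) (𝟙 _)
  let σ (n : ℤ) := ShortComplex.Splitting.ofExactOfRetraction _ (hS n).exact (r n) (hr n)
    (hS n).epi_g
  refine ⟨HomologicalComplex.Hom.isoOfComponents (fun n => (σ n).isoBinaryBiproduct) ?_⟩
  rintro _ j rfl
  have hdr : K.d (j + 1) j ≫ r j = K.pOpcycles (j + 1) := by
    rw [← K.p_fromOpcycles, Category.assoc, hr, Category.comp_id]
  refine biprod.hom_ext _ _ ?_ ?_
  · simpa [σ, ShortComplex.Splitting.ofExactOfRetraction] using hdr.symm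
  · simp [σ]

/-- In an acyclic complex, the opcycles agree with the cycles one degree below. -/
noncomputable def opcyclesIsoCycles {K : ChainComplex 𝒜 ℤ} (hK : K.Acyclic) {i j : ℤ}
    (hij : j + 1 = i) : K.opcycles i ≅ K.cycles j :=
  have := (shortExact_opcycles K (c := ComplexShape.down ℤ) hij (hK i)).mono_f
  have : Mono (K.opcyclesToCycles i j) :=
    mono_of_mono_fac (K.opcyclesToCycles_iCycles i j)
  have : Epi (K.toCycles i j) := by
    obtain rfl : (ComplexShape.down ℤ).prev j = i := by simpa using hij
    exact (hK j).epi_toCycles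
  have : Epi (K.opcyclesToCycles i j) :=
    epi_of_epi_fac (K.pOpcycles_opcyclesToCycles i j)
  have := isIso_of_mono_of_epi (K.opcyclesToCycles i j)
  asIso (K.opcyclesToCycles i j)

end Disks

section TensorHom

variable {R : Type*} [CommRing R]
  {L K N F P : Type*} [AddCommGroup L] [Module R L] [AddCommGroup K] [Module R K]
  [AddCommGroup N] [Module R N] [AddCommGroup F] [Module R F] [AddCommGroup P] [Module R P]

lemma rTensorHomToHomRTensor_rTensor_lcomp (f : K →ₗ[R] L) (t : (L →ₗ[R] N) ⊗[R] F) :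
    TensorProduct.rTensorHomToHomRTensor (.id R) K N F ((LinearMap.lcomp R N f).rTensor F t) =
      TensorProduct.rTensorHomToHomRTensor (.id R) L N F t ∘ₗ f := by
  induction t with
  | zero => simp
  | add x y hx hy => simp only [map_add, hx, hy, LinearMap.add_comp]
  | tmul φ y => ext; simp

lemma rTensorHomToHomRTensor_surjective [Module.FinitePresentation R K] [Module.Flat R F] :
    Function.Surjective (TensorProduct.rTensorHomToHomRTensor (.id R) K N F) := by
  intro g
  obtain ⟨n, m, q, d, hq, hdq⟩ := Module.FinitePresentation.exists_fin' R K
  obtain ⟨t, ht⟩ := (rTensorHomEquivHomRTensor R (Fin n → R) N F).surjective (g ∘ₗ q)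
  rw [rTensorHomEquivHomRTensor_apply] at ht
  have ht_zero : (LinearMap.lcomp R N d).rTensor F t = 0 := by
    apply (rTensorHomEquivHomRTensor R (Fin m → R) N F).injective
    rw [rTensorHomEquivHomRTensor_apply, rTensorHomToHomRTensor_rTensor_lcomp, ht, map_zero,
      LinearMap.comp_assoc, hdq.linearMap_comp_eq_zero, LinearMap.comp_zero]
  have hexact : Function.Exact (LinearMap.lcomp R N q) (LinearMap.lcomp R N d) :=
    LinearMap.exact_lcomp_of_exact_of_surjective N hdq hq
  obtain ⟨t', rfl⟩ := (Module.Flat.rTensor_exact F hexact t).1 ht_zero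
  rw [rTensorHomToHomRTensor_rTensor_lcomp] at ht
  exact ⟨t', (LinearMap.cancel_right hq).1 ht⟩

/-- Every `K ⟶ N ⊗ F` comes from `Hom(K, N) ⊗ F`, where extensions along `j` are found
tensorwise. -/
lemma lcomp_tensorProduct_surjective [Module.FinitePresentation R K] [Module.Flat R F]
    {j : K →ₗ[R] L} (hj : Function.Surjective (LinearMap.lcomp R N j)) :
    Function.Surjective (LinearMap.lcomp R (N ⊗[R] F) j) := by
  intro g
  obtain ⟨t, rfl⟩ := rTensorHomToHomRTensor_surjective g
  obtain ⟨t', rfl⟩ := LinearMap.rTensor_surjective F hj t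
  exact ⟨_, (rTensorHomToHomRTensor_rTensor_lcomp j t').symm⟩

lemma lcomp_rTensor_surjective [Module.Projective R P] {j : K →ₗ[R] L}
    (hj : Function.Surjective (LinearMap.lcomp R N j)) :
    Function.Surjective (LinearMap.lcomp R N (j.rTensor P)) := by
  intro u
  obtain ⟨v, hv⟩ := Module.projective_lifting_property (LinearMap.lcomp R N j)
    (TensorProduct.curry u).flip hj
  refine ⟨TensorProduct.lift v.flip, TensorProduct.ext' fun k p => ?_⟩
  simpa using LinearMap.congr_fun (LinearMap.congr_fun hv p) k

end TensorHom

section Modules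

variable {R : Type u} [CommRing R]

lemma shortExact_rTensor {A B D : ModuleCat.{u} R} {i : A ⟶ B} {p : B ⟶ D} {w : i ≫ p = 0}
    (h : (ShortComplex.mk i p w).ShortExact) (F : Type u) [AddCommGroup F] [Module R F]
    [Module.Flat R F] :
    (ShortComplex.mk (ModuleCat.ofHom (i.hom.rTensor F)) (ModuleCat.ofHom (p.hom.rTensor F))
      (by rw [← ModuleCat.ofHom_comp, ← LinearMap.rTensor_comp, ← ModuleCat.hom_comp, w,
        ModuleCat.hom_zero, LinearMap.rTensor_zero]; rfl)).ShortExact :=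
  ModuleCat.shortComplex_shortExact _
    (Module.Flat.rTensor_exact F
      ((ShortComplex.ShortExact.moduleCat_exact_iff_function_exact _).1 h.exact))
    (Module.Flat.rTensor_preserves_injective_linearMap _ h.moduleCat_injective_f)
    (LinearMap.rTensor_surjective _ h.moduleCat_surjective_g)

lemma subsingleton_ext_one_iff_lcomp_surjective {A B D N : ModuleCat.{u} R} [Projective B]
    {i : A ⟶ B} {p : B ⟶ D} {w : i ≫ p = 0} (h : (ShortComplex.mk i p w).ShortExact) :
    Subsingleton (Ext D N 1) ↔ Function.Surjective (LinearMap.lcomp R N i.hom) := by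
  refine ⟨fun hD φ => ?_, fun hi => ?_⟩
  · obtain ⟨g, hg⟩ := exists_extension_of_subsingleton_ext_one h hD (ModuleCat.ofHom φ)
    exact ⟨g.hom, congrArg ModuleCat.Hom.hom hg⟩
  · refine subsingleton_ext_one_of_exists_extension h (extOrthogonal_of_projective B N 0)
      fun f => ?_
    obtain ⟨φ, hφ⟩ := hi f.hom
    exact ⟨ModuleCat.ofHom φ, ModuleCat.hom_ext hφ⟩

lemma finitePresentation_opcycles {ι : Type*} {c : ComplexShape ι}
    (K : HomologicalComplex (ModuleCat.{u} R) c) {i j : ι} (hij : c.prev j = i)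
    [Module.Finite R (K.X i)] [Module.FinitePresentation R (K.X j)] :
    Module.FinitePresentation R (K.opcycles j) := by
  have hexact : Function.Exact (K.d i j).hom (K.pOpcycles j).hom :=
    (ShortComplex.ShortExact.moduleCat_exact_iff_function_exact _).1
      (ShortComplex.exact_of_g_is_cokernel (ShortComplex.mk _ _ (K.d_pOpcycles i j))
        (K.opcyclesIsCokernel i j hij))
  refine Module.finitePresentation_of_surjective (K.pOpcycles j).hom
    ((ModuleCat.epi_iff_surjective _).1 inferInstance) ?_
  rw [hexact.linearMap_ker_eq]
  exact Submodule.fg_range _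

theorem ExtOrthogonal.tensorProduct_right {X N : ModuleCat.{u} R} (h : ExtOrthogonal X N)
    (L : ProjectiveResolution X) (hL : ∀ n, Module.Finite R (L.complex.X n))
    (F : Type u) [AddCommGroup F] [Module R F] [Module.Flat R F] :
    ExtOrthogonal X (ModuleCat.of R (N ⊗[R] F)) := by
  have hs (n : ℕ) := shortExact_opcycles L.complex (c := ComplexShape.down ℕ) (i := n + 1) rfl
    (L.complex_exactAt_succ n)
  have e : L.complex.opcycles 0 ≅ X :=
    (L.complex.opcyclesIsCokernel 1 0 (by simp)).coconePointUniqueUpToIso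
      L.isColimitCokernelCofork
  refine (extOrthogonal_of_syzygies (𝒮 := fun K => ∃ n, K = L.complex.opcycles n ∧
    ExtOrthogonal K N) ?_ ?_ ⟨0, rfl, h.of_iso e.symm (Iso.refl N)⟩).of_iso e (Iso.refl _)
  · rintro _ ⟨n, rfl, h⟩
    have : Module.Projective R (L.complex.X (n + 1)) :=
      (L.complex.X (n + 1)).projective_of_module_projective
    have := Module.finitePresentation_of_projective R (L.complex.X (n + 1))
    have := finitePresentation_opcycles L.complex (i := n + 2) (j := n + 1) (by simp)
    exact (subsingleton_ext_one_iff_lcomp_surjective (hs n)).2 (lcomp_tensorProduct_surjective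
      ((subsingleton_ext_one_iff_lcomp_surjective (hs n)).1 (h 0)))
  · rintro _ ⟨n, rfl, h⟩
    exact ⟨_, _, ⟨n + 1, rfl, (HasSES.of_shortExact (hs n)).extOrthogonal_left
      (extOrthogonal_of_projective _ _) h⟩, extOrthogonal_of_projective _ _,
      HasSES.of_shortExact (hs n)⟩

theorem ExtOrthogonal.tensorProduct_left {X N : ModuleCat.{u} R} (h : ExtOrthogonal X N)
    (P : Type u) [AddCommGroup P] [Module R P] [Module.Projective R P] :
    ExtOrthogonal (ModuleCat.of R (X ⊗[R] P)) N := by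
  have hπ (X : ModuleCat.{u} R) : (ShortComplex.mk (kernel.ι (Projective.π X)) (Projective.π X)
      (kernel.condition _)).ShortExact := { exact := ShortComplex.exact_kernel _ }
  refine extOrthogonal_of_syzygies (𝒮 := fun K => ∃ X : ModuleCat.{u} R,
    K = ModuleCat.of R (X ⊗[R] P) ∧ ExtOrthogonal X N) ?_ ?_ ⟨X, rfl, h⟩
  · rintro _ ⟨X, rfl, h⟩
    exact (subsingleton_ext_one_iff_lcomp_surjective (shortExact_rTensor (hπ X) P)).2
      (lcomp_rTensor_surjective ((subsingleton_ext_one_iff_lcomp_surjective (hπ X)).1 (h 0)))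
  · rintro _ ⟨X, rfl, h⟩
    exact ⟨_, _, ⟨_, rfl, (HasSES.of_shortExact (hπ X)).extOrthogonal_left
      (extOrthogonal_of_projective _ _) h⟩, extOrthogonal_of_projective _ _,
      HasSES.of_shortExact (shortExact_rTensor (hπ X) P)⟩

variable {C : ModuleCat.{u} R}

lemma IsSemidualizing.leftExtOrthogonal_cFlatModules (hC : IsSemidualizing C) :
    leftExtOrthogonal (cFlatModules C) C := by
  rintro N ⟨F, _, ⟨e⟩⟩
  obtain ⟨L, hL⟩ := hC.exists_finite_resolution
  have hCC : ExtOrthogonal C C := fun i => hC.ext_vanishing (i + 1) (by lia)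
  exact (hCC.tensorProduct_right L hL F).of_iso (Iso.refl C) e.toModuleIso.symm

lemma cProjectiveModules_le_leftExtOrthogonal (hC : leftExtOrthogonal (cFlatModules C) C) :
    cProjectiveModules C ≤ leftExtOrthogonal (cFlatModules C) := by
  rintro M ⟨P, _, ⟨e⟩⟩ N hN
  exact ((hC N hN).tensorProduct_left P).of_iso e.toModuleIso.symm (Iso.refl N)

end Modules

section Tilde

variable {R : Type u} [CommRing R]

section

variable (C : ModuleCat.{u} R)

instance : (projectiveModules R).IsClosedUnderIsomorphisms where
  of_iso e h := by
    dsimp only [projectiveModules] at h ⊢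
    exact Module.Projective.of_equiv e.toLinearEquiv

instance : (cProjectiveModules C).IsClosedUnderIsomorphisms where
  of_iso e := fun ⟨P, hP, ⟨f⟩⟩ => ⟨P, hP, ⟨e.symm.toLinearEquiv.trans f⟩⟩

instance : (cFlatModules C).IsClosedUnderIsomorphisms where
  of_iso e := fun ⟨F, hF, ⟨f⟩⟩ => ⟨F, hF, ⟨e.symm.toLinearEquiv.trans f⟩⟩

instance : (cProjectiveModules C).ContainsZero where
  exists_zero := ⟨ModuleCat.of R (C ⊗[R] PUnit.{u + 1}),
    ModuleCat.isZero_of_iff_subsingleton.2 inferInstance,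
    ModuleCat.of R PUnit.{u + 1}, inferInstanceAs (Module.Projective R PUnit.{u + 1}),
    ⟨LinearEquiv.refl R _⟩⟩

variable {C}

lemma cProjectiveModules_biprod (A B : ModuleCat.{u} R) (hA : cProjectiveModules C A)
    (hB : cProjectiveModules C B) : cProjectiveModules C (A ⊞ B) := by
  obtain ⟨P, hP, ⟨e⟩⟩ := hA
  obtain ⟨Q, hQ, ⟨f⟩⟩ := hB
  exact ⟨ModuleCat.of R (P × Q), inferInstanceAs (Module.Projective R (P × Q)),
    ⟨((ModuleCat.biprodIsoProd A B).toLinearEquiv.trans (e.prodCongr f)).trans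
      (TensorProduct.prodRight R R C P Q).symm⟩⟩

lemma cProjectiveModules_le_cFlatModules : cProjectiveModules C ≤ cFlatModules C :=
  fun _ ⟨P, _, e⟩ => ⟨P, inferInstance, e⟩

end

variable {𝒳 : ObjectProperty (ModuleCat.{u} R)} [𝒳.IsClosedUnderIsomorphisms]

lemma tilde_iff_opcycles {K : Ch R} (hK : K.Acyclic) : tilde 𝒳 K ↔ ∀ n, 𝒳 (K.opcycles n) :=
  ⟨fun h n => 𝒳.prop_of_iso (opcyclesIsoCycles hK (sub_add_cancel n 1)).symm (h.2 (n - 1)),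
    fun h => ⟨hK, fun n => 𝒳.prop_of_iso (opcyclesIsoCycles hK rfl) (h (n + 1))⟩⟩

lemma tilde_disks {M : ℤ → ModuleCat.{u} R} (hM : ∀ n, 𝒳 (M n)) : tilde 𝒳 (disks M) :=
  (tilde_iff_opcycles disks.acyclic).2 fun n => 𝒳.prop_of_iso (disks.opcyclesIso n).symm (hM n)

instance [𝒳.ContainsZero] : (tilde 𝒳).ContainsZero where
  exists_zero := by
    obtain ⟨Z, hZ⟩ := HasZeroObject.zero (C := Ch R)
    have hX (n : ℤ) : IsZero (Z.X n) := (HomologicalComplex.eval _ _ n).map_isZero hZ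
    exact ⟨Z, hZ, fun n => HomologicalComplex.ExactAt.of_isZero (hX n),
      fun n => 𝒳.prop_of_isZero ((hX n).of_mono (HomologicalComplex.iCycles _ n))⟩

lemma cyclesMap_add {κ : Type*} {c : ComplexShape κ} {K L : HomologicalComplex 𝒜 c} (f g : K ⟶ L)
    (n : κ) : HomologicalComplex.cyclesMap (f + g) n =
      HomologicalComplex.cyclesMap f n + HomologicalComplex.cyclesMap g n := by
  rw [← cancel_mono (L.iCycles n)]
  simp

instance {κ : Type*} (c : ComplexShape κ) (n : κ) :
    (HomologicalComplex.cyclesFunctor 𝒜 c n).Additive where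
  map_add := cyclesMap_add _ _ n

lemma tilde_biprod (h𝒳 : ∀ A B, 𝒳 A → 𝒳 B → 𝒳 (A ⊞ B)) (K L : Ch R) (hK : tilde 𝒳 K)
    (hL : tilde 𝒳 L) : tilde 𝒳 (K ⊞ L) := by
  have (n : ℤ) := preservesBinaryBiproducts_of_preservesBiproducts
    (HomologicalComplex.homologyFunctor (ModuleCat.{u} R) (ComplexShape.down ℤ) n)
  have (n : ℤ) := preservesBinaryBiproducts_of_preservesBiproducts
    (HomologicalComplex.cyclesFunctor (ModuleCat.{u} R) (ComplexShape.down ℤ) n)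
  refine ⟨fun n => ?_, fun n => ?_⟩
  · rw [HomologicalComplex.exactAt_iff_isZero_homology]
    exact ((biprod_isZero_iff _ _).2 ⟨(hK.1 n).isZero_homology, (hL.1 n).isZero_homology⟩).of_iso
      ((HomologicalComplex.homologyFunctor _ _ n).mapBiprod K L)
  · exact 𝒳.prop_of_iso ((HomologicalComplex.cyclesFunctor _ _ n).mapBiprod K L).symm
      (h𝒳 _ _ (hK.2 n) (hL.2 n))

lemma exists_hasSES_tilde_projectiveModules (X : Ch R) :
    ∃ K P : Ch R, tilde (projectiveModules R) P ∧ HasSES K P X := by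
  let π := disks.desc fun n => Projective.π (X.X n)
  have : Epi π := HomologicalComplex.epi_of_epi_f _ fun n =>
    epi_of_epi_fac (f := biprod.inr) (h := Projective.π (X.X n)) (by simp [π])
  exact ⟨_, _, tilde_disks fun n => (Projective.over (X.X n)).projective_of_module_projective,
    HasSES.of_epi π⟩

variable [HasExt.{w} (Ch R)]

lemma tilde_projectiveModules_le_leftExtOrthogonal (ℬ : ObjectProperty (Ch R)) :
    tilde (projectiveModules R) ≤ leftExtOrthogonal ℬ := by
  intro P hP
  have (n : ℤ) : Projective (P.opcycles n) := by
    have : Module.Projective R (P.opcycles n) := (tilde_iff_opcycles hP.1).1 hP n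
    infer_instance
  obtain ⟨e⟩ := nonempty_iso_disks_opcycles hP.1
    fun n => extOrthogonal_of_projective (P.opcycles n) _ 0
  exact (leftExtOrthogonal ℬ).prop_of_iso e.symm fun B _ => extOrthogonal_of_projective _ B

variable {C : ModuleCat.{u} R} (hC : leftExtOrthogonal (cFlatModules C) C)

include hC

lemma tilde_cProjectiveModules_le_leftExtOrthogonal :
    tilde (cProjectiveModules C) ≤ leftExtOrthogonal (tilde (cFlatModules C)) := by
  intro Q hQ
  have hQ' := (tilde_iff_opcycles hQ.1).1 hQ
  have h𝒫 := cProjectiveModules_le_leftExtOrthogonal hC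
  obtain ⟨e⟩ := nonempty_iso_disks_opcycles hQ.1 fun n =>
    h𝒫 _ (hQ' n) _ (cProjectiveModules_le_cFlatModules _ (hQ' (n + 1))) 0
  refine (leftExtOrthogonal _).prop_of_iso e.symm fun H hH => extOrthogonal_disks fun n => ?_
  have hH' := (tilde_iff_opcycles hH.1).1 hH
  exact (hasSES_opcycles H hH.1 n).extOrthogonal_target_middle
    (h𝒫 _ (hQ' n) _ (hH' (n + 1))) (h𝒫 _ (hQ' n) _ (hH' n))

omit hC [HasExt.{w} (Ch R)] in
lemma isDCProjective_iff_hasCompleteResolution {X : Ch R} :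
    IsDCProjective C X ↔ HasCompleteResolution (tilde (cFlatModules C))
      (tilde (projectiveModules R)) (tilde (cProjectiveModules C)) X :=
  exists_congr fun E => and_congr_right fun hE => and_congr_right fun _ =>
    and_congr_right fun _ => and_congr_right fun _ =>
      (opcyclesIsoImage E hE (by simp)).isoCongrRight.nonempty_congr.symm

theorem isDCProjective_iff_coresolved {X : Ch R} :
    IsDCProjective C X ↔
      coresolved (leftExtOrthogonal (tilde (cFlatModules C))) (tilde (cProjectiveModules C)) X := by
  have h𝒯 := tilde_projectiveModules_le_leftExtOrthogonal (tilde (cFlatModules C))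
  rw [isDCProjective_iff_hasCompleteResolution]
  refine ⟨fun hX => hX.coresolved h𝒯 (tilde_cProjectiveModules_le_leftExtOrthogonal hC),
    fun hX => hasCompleteResolution_of_coresolved le_rfl (fun X hX => ?_) (coresolved_le X hX) hX⟩
  obtain ⟨K, P, hP, h⟩ := exists_hasSES_tilde_projectiveModules X
  exact ⟨K, P, fun B hB => h.extOrthogonal_left (h𝒯 P hP B hB) (hX B hB), hP, h⟩

end Tilde

end DingComplex

open DingComplex in
theorem theorem2p16_general {R : Type u} [CommRing R] (C : ModuleCat.{u} R)
    (hC : leftExtOrthogonal (cFlatModules C) C) (X : Ch R) :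
    IsDCProjective C X ↔
      ∃ G : ChainComplex (Ch R) ℤ, G.Acyclic ∧ IsHomExact G (tilde (cFlatModules C)) ∧
        (∀ i : ℤ, IsDCProjective C (G.X i)) ∧ Nonempty (X ≅ Limits.cokernel (G.d 1 0)) := by
  have := HasExt.standard (Ch R)
  let 𝒢 := coresolved (leftExtOrthogonal (tilde (cFlatModules C))) (tilde (cProjectiveModules C))
  have h𝒢 : IsDCProjective C = 𝒢 := funext fun _ => propext (isDCProjective_iff_coresolved hC)
  rw [h𝒢]
  refine Iff.trans ⟨fun hX => ?_, fun hX => ?_⟩ hasCompleteResolution_self_iff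
  · obtain ⟨Z, hZ, hZ𝒢⟩ := 𝒢.exists_prop_of_containsZero
    refine hasCompleteResolution_of_coresolved coresolved_le
      (fun Y hY => ⟨Z, Y, hZ𝒢, hY, HasSES.of_isZero_left hZ (Iso.refl Y)⟩) hX
      (le_coresolved coresolved_le (fun Y hY => ?_) X hX)
    exact ⟨Y, Z, hY, hZ𝒢, HasSES.of_isZero_right (Iso.refl Y) hZ⟩
  · refine coresolved_coresolved_le (fun V Q hV hQ => hV Q ?_ 0)
      (tilde_biprod cProjectiveModules_biprod) X (hX.coresolved coresolved_le coresolved_le)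
    exact ⟨hQ.1, fun i => cProjectiveModules_le_cFlatModules _ (hQ.2 i)⟩

theorem theorem2p16 {R : Type u} [CommRing R] (C : ModuleCat.{u} R)
    (hC : DingComplex.IsSemidualizing C) (X : DingComplex.Ch R) :
    DingComplex.IsDCProjective C X ↔
      ∃ G : ChainComplex (DingComplex.Ch R) ℤ,
        G.Acyclic ∧
        DingComplex.IsHomExact G (DingComplex.tilde (DingComplex.cFlatModules C)) ∧
        (∀ i : ℤ, DingComplex.IsDCProjective C (G.X i)) ∧
        Nonempty (X ≅ Limits.cokernel (G.d 1 0)) :=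
  theorem2p16_general C hC.leftExtOrthogonal_cFlatModules X
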